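/- Let $k$ be a unitary commutative ring and $\lambda\in k$. A derivation of weight $\lambda$ on a unitary $k$-algebra $R$ is a $k$-linear map $d\colon R\to R$ with $d(xy)=d(x)y+x\,d(y)+\lambda\,d(x)d(y)$ and $d(1)=0$; $(R,d)$ is then a differential algebra of weight $\lambda$. A differential Rota-Baxter algebra of weight $\lambda$ is a triple $(R,d,P)$ where $(R,d)$ is a differential algebra of weight $\lambda$ and $P\colon R\to R$ is $k$-linear with $P(x)P(y)=P(xP(y))+P(P(x)y)+\lambda P(xy)$ and $d\circ P=\mathrm{id}_R$. An integro-differential algebra of weight $\lambda$ is a triple $(R,d,P)$ where $(R,d)$ is a differential algebra of weight $\lambda$ and $P\colon R\to R$ is $k$-linear with $d\circ P=\mathrm{id}_R$ and $P(d(x))P(d(y))=P(d(x))y+xP(d(y))-P(d(xy))$. A free commutative integro-differential (resp. differential Rota-Baxter) algebra of weight $\lambda$ on a commutative differential algebra $(A,d)$ of weight $\lambda$ is a commutative such algebra $(F,D,P)$ with a unitary $k$-algebra homomorphism $i\colon A\to F$ satisfying $i\circ d=D\circ i$, such that for every commutative integro-differential (resp. differential Rota-Baxter) algebra $(R,\delta,Q)$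 of weight $\lambda$ and every unitary $k$-algebra homomorphism $f\colon A\to R$ with $f\circ d=\delta\circ f$ there is a unique unitary $k$-algebra homomorphism $\bar f\colon F\to R$ with $\bar f\circ D=\delta\circ\bar f$, $\bar f\circ P=Q\circ\bar f$ and $\bar f\circ i=f$. Let $(A,d)$ be a commutative differential $k$-algebra of weight $\lambda$. Let $Ш(A)=\bigoplus_{n\ge 0}A^{\otimes(n+1)}$ (tensor products over $k$), with the bilinear product $(a_0\otimes \bar a)(b_0\otimes\bar b)=a_0b_0\otimes(\bar a\,ш_\lambda\,\bar b)$, where $ш_\lambda$ is the mixable shuffle product of weight $\lambda$ on $\bigoplus_{n\ge0}A^{\otimes n}$, that is, the bilinear product with the empty word as unit and $$(a\otimes u)\,ш_\lambda\,(b\otimes v)=a\otimes\big(u\,ш_\lambda\,(b\otimes v)\big)+b\otimes\big((a\otimes u)\,ш_\lambda\, v\big)+\lambda\,(ab)\otimes(u\,ш_\lambda\, v).$$ Let $P_A(a_0\otimes\cdots\otimes a_n)=1\otimes a_0\otimes\cdots\otimes a_n$, let $$d_A(a_0\otimes\cdots\otimes a_n)=d(a_0)\otimes a_1\otimes\cdots\otimes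 a_n+a_0a_1\otimes a_2\otimes\cdots\otimes a_n+\lambda\, d(a_0)a_1\otimes a_2\otimes\cdots\otimes a_n$$ for $n\ge 1$ and $d_A(a_0)=d(a_0)$, and let $j_A\colon A\to Ш(A)$ be the inclusion of the summand $n=0$. Then $(Ш(A),d_A,P_A)$ with $j_A$ is a free commutative differential Rota-Baxter algebra of weight $\lambda$ on $(A,d)$. Put $J=P_A\circ d_A$ and $E=\mathrm{id}-J$, and let $I$ be the differential Rota-Baxter ideal of $Ш(A)$ (ideal closed under $d_A$ and $P_A$) generated by $$\{\,J(E(x)J(y))-E(x)J(y)\;:\;x,y\in Ш(A)\,\}.$$ Then $Ш(A)/I$ with the operators induced by $d_A$ and $P_A$ is a differential Rota-Baxter algebra of weight $\lambda$, and, together with the composite $A\xrightarrow{j_A}Ш(A)\to Ш(A)/I$, it is a free commutative integro-differential algebra of weight $\lambda$ on $(A,d)$. In particular, every commutative differential algebra of weight $\lambda$ has a free commutative integro-differential algebra on it. -/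

import Mathlib

open scoped TensorProduct

universe u v w

noncomputable section

/-! ## Operators on algebras -/

section Operators

variable {k : Type*} [CommRing k] {R : Type*} [Ring R] [Algebra k R]

/-- `d` is a derivation of weight `lam` on the unitary associative `k`-algebra `R`. -/
structure IsWeightedDerivation (lam : k) (d : R →ₗ[k] R) : Prop where
  leibniz : ∀ x y, d (x * y) = d x * y + x * d y + lam • (d x * d y)
  map_one : d 1 = 0

/-- `P` is a Rota-Baxter operator of weight `lam` on `R`. -/
def IsRotaBaxterOperator (lam : k) (P : R →ₗ[k] R) : Prop :=
  ∀ x y, P x * P y = P (x * P y) + P (P x * y) + lam • P (x * y)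

/-- `(R, d, P)` is a differential Rota-Baxter algebra of weight `lam`. -/
structure IsDifferentialRotaBaxter (lam : k) (d P : R →ₗ[k] R) : Prop where
  derivation : IsWeightedDerivation lam d
  rotaBaxter : IsRotaBaxterOperator lam P
  comp_eq_id : d ∘ₗ P = LinearMap.id

/-- `(R, d, P)` is an integro-differential algebra of weight `lam`. -/
structure IsIntegroDifferential (lam : k) (d P : R →ₗ[k] R) : Prop where
  derivation : IsWeightedDerivation lam d
  comp_eq_id : d ∘ₗ P = LinearMap.id
  hybrid : ∀ x y, P (d x) * P (d y) = P (d x) * y + x * P (d y) - P (d (x * y))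

/-- The initialization `J = P ∘ d`. -/
def initialization (d P : R →ₗ[k] R) : R →ₗ[k] R := P ∘ₗ d

/-- The evaluation `E = id - P ∘ d`. -/
def evaluation (d P : R →ₗ[k] R) : R →ₗ[k] R := LinearMap.id - P ∘ₗ d

end Operators

/-! ## Universal properties -/

section Free

variable {k : Type*} [CommRing k] {A : Type*} [CommRing A] [Algebra k A]
  {F : Type*} [CommRing F] [Algebra k F]

/-- The commutative algebra `F` with operators `D`, `P` and the map `i : A → F` is a free commutative
differential Rota-Baxter algebra of weight `lam` on the differential algebra `(A, d)`. -/
structure IsFreeCommDifferentialRotaBaxter (lam : k) (d : A →ₗ[k] A) (D P : F →ₗ[k] F)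
    (i : A →ₐ[k] F) : Prop where
  isDifferentialRotaBaxter : IsDifferentialRotaBaxter lam D P
  map_derivation : ∀ a, i (d a) = D (i a)
  existsUnique_lift : ∀ (R : Type w) [CommRing R] [Algebra k R] (δ Q : R →ₗ[k] R),
    IsDifferentialRotaBaxter lam δ Q →
    ∀ f : A →ₐ[k] R, (∀ a, f (d a) = δ (f a)) →
      ∃! g : F →ₐ[k] R,
        (∀ x, g (D x) = δ (g x)) ∧ (∀ x, g (P x) = Q (g x)) ∧ g.comp i = f

/-- The commutative algebra `F` with operators `D`, `P` and the map `i : A → F` is a free commutative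
integro-differential algebra of weight `lam` on the differential algebra `(A, d)`. -/
structure IsFreeCommIntegroDifferential (lam : k) (d : A →ₗ[k] A) (D P : F →ₗ[k] F)
    (i : A →ₐ[k] F) : Prop where
  isIntegroDifferential : IsIntegroDifferential lam D P
  map_derivation : ∀ a, i (d a) = D (i a)
  existsUnique_lift : ∀ (R : Type w) [CommRing R] [Algebra k R] (δ Q : R →ₗ[k] R),
    IsIntegroDifferential lam δ Q →
    ∀ f : A →ₐ[k] R, (∀ a, f (d a) = δ (f a)) →
      ∃! g : F →ₐ[k] R,
        (∀ x, g (D x) = δ (g x)) ∧ (∀ x, g (P x) = Q (g x)) ∧ g.comp i = f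

end Free

/-! ## Differential Rota-Baxter ideals and quotients -/

section Ideals

variable {k : Type*} [CommRing k] {R : Type*} [CommRing R] [Algebra k R]

/-- A differential Rota-Baxter ideal of `(R, d, P)`: an ideal closed under `d` and `P`. -/
def IsDifferentialRotaBaxterIdeal (d P : R →ₗ[k] R) (I : Ideal R) : Prop :=
  (∀ x ∈ I, d x ∈ I) ∧ ∀ x ∈ I, P x ∈ I

/-- The differential Rota-Baxter ideal generated by a set: the smallest one that contains it. -/
def differentialRotaBaxterSpan (d P : R →ₗ[k] R) (S : Set R) : Ideal R :=
  sInf {I | IsDifferentialRotaBaxterIdeal d P I ∧ S ⊆ I}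

theorem isDifferentialRotaBaxterIdeal_span (d P : R →ₗ[k] R) (S : Set R) :
    IsDifferentialRotaBaxterIdeal d P (differentialRotaBaxterSpan d P S) := by
  constructor <;> intro x hx <;> rw [differentialRotaBaxterSpan, Submodule.mem_sInf] at hx ⊢ <;>
    intro I hI
  · exact hI.1.1 x (hx I hI)
  · exact hI.1.2 x (hx I hI)

/-- The operator on `R ⧸ I` induced by a linear operator `T` that maps `I` into itself. -/
def quotientOperator (I : Ideal R) (T : R →ₗ[k] R) (h : ∀ x ∈ I, T x ∈ I) :
    (R ⧸ I) →ₗ[k] (R ⧸ I) where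
  toFun := Quotient.lift (fun x => Ideal.Quotient.mk I (T x)) fun x y hxy => by
    have hm : x - y ∈ I := (Submodule.quotientRel_def I).1 hxy
    have := h _ hm
    rw [map_sub] at this
    exact Ideal.Quotient.eq.2 this
  map_add' := by
    rintro ⟨x⟩ ⟨y⟩
    change Ideal.Quotient.mk I (T (x + y)) = Ideal.Quotient.mk I (T x) + Ideal.Quotient.mk I (T y)
    rw [map_add, map_add]
  map_smul' := by
    rintro c ⟨x⟩
    change Ideal.Quotient.mk I (T (c • x)) = c • Ideal.Quotient.mk I (T x)
    rw [map_smul]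
    rfl

@[simp]
theorem quotientOperator_mk (I : Ideal R) (T : R →ₗ[k] R) (h : ∀ x ∈ I, T x ∈ I) (x : R) :
    quotientOperator I T h (Ideal.Quotient.mk I x) = Ideal.Quotient.mk I (T x) := rfl

/-- The differential Rota-Baxter ideal generated by all `J (E x * J y) - E x * J y`. -/
def integroDifferentialIdeal (d P : R →ₗ[k] R) : Ideal R :=
  differentialRotaBaxterSpan d P
    {z | ∃ x y, z = initialization d P (evaluation d P x * initialization d P y)
      - evaluation d P x * initialization d P y}

/-- The derivation induced on the quotient by `integroDifferentialIdeal d P`. -/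
def quotientDerivation (d P : R →ₗ[k] R) :
    (R ⧸ integroDifferentialIdeal d P) →ₗ[k] (R ⧸ integroDifferentialIdeal d P) :=
  quotientOperator _ d (isDifferentialRotaBaxterIdeal_span d P _).1

/-- The Rota-Baxter operator induced on the quotient by `integroDifferentialIdeal d P`. -/
def quotientIntegral (d P : R →ₗ[k] R) :
    (R ⧸ integroDifferentialIdeal d P) →ₗ[k] (R ⧸ integroDifferentialIdeal d P) :=
  quotientOperator _ P (isDifferentialRotaBaxterIdeal_span d P _).2

end Ideals

/-! ## The mixable shuffle algebra -/

/-- The underlying module of the mixable shuffle (quasi-shuffle) algebra of weight `lam` on `A`, that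
is `T(A) = ⨁ₙ A^{⊗ n}`, tensor products over `k`. It carries below the mixable shuffle product,
and not the product of the tensor algebra. -/
def MixableShuffle {k : Type*} [CommRing k] (_lam : k) (A : Type*) [CommRing A] [Algebra k A] :
    Type _ :=
  TensorAlgebra k A

namespace MixableShuffle

variable {k : Type*} [CommRing k] {lam : k} {A : Type*} [CommRing A] [Algebra k A]

instance : AddCommGroup (MixableShuffle lam A) :=
  inferInstanceAs (AddCommGroup (TensorAlgebra k A))

instance : Module k (MixableShuffle lam A) :=
  inferInstanceAs (Module k (TensorAlgebra k A))

/-- The empty word: the unit of `A^{⊗ 0} = k`. -/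
def nil : MixableShuffle lam A := (1 : TensorAlgebra k A)

/-- `cons a (a₁ ⊗ ⋯ ⊗ aₙ) = a ⊗ a₁ ⊗ ⋯ ⊗ aₙ`. -/
def cons : A →ₗ[k] MixableShuffle lam A →ₗ[k] MixableShuffle lam A :=
  (LinearMap.mul k (TensorAlgebra k A)) ∘ₗ (TensorAlgebra.ι k)

theorem induction {p : MixableShuffle lam A → Prop} (h_nil : p nil)
    (h_cons : ∀ a w, p w → p (cons a w)) (h_add : ∀ v w, p v → p w → p (v + w))
    (h_smul : ∀ (c : k) w, p w → p (c • w)) (w : MixableShuffle lam A) : p w := by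
  suffices H : ∀ x : TensorAlgebra k A, ∀ v : TensorAlgebra k A,
      p v → p (x * v : TensorAlgebra k A) by
    exact (congrArg p (mul_one (M := TensorAlgebra k A) w)).mp (H w 1 h_nil)
  intro x
  induction x using TensorAlgebra.induction with
  | algebraMap c =>
    intro v hv
    rw [← Algebra.smul_def]
    exact h_smul c v hv
  | ι a => exact fun v hv => h_cons a v hv
  | mul x y hx hy =>
    intro v hv
    rw [mul_assoc]
    exact hx _ (hy v hv)
  | add x y hx hy =>
    intro v hv
    rw [add_mul]
    exact h_add _ _ (hx v hv) (hy v hv)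

section Recursion

variable {N : Type*} [AddCommGroup N] [Module k N]

/-- The auxiliary operator `(w, r) ↦ (cons a w, h a w + s a r)` for the recursion on words. -/
def recStep (h : A →ₗ[k] MixableShuffle lam A →ₗ[k] N) (s : A →ₗ[k] N →ₗ[k] N) :
    A →ₗ[k] Module.End k (MixableShuffle lam A × N) where
  toFun a := ((cons a) ∘ₗ LinearMap.fst k _ _).prod
    ((h a) ∘ₗ LinearMap.fst k _ _ + (s a) ∘ₗ LinearMap.snd k _ _)
  map_add' a b := by
    ext x <;> simp
  map_smul' c a := by
    ext x <;> simp

theorem recStep_apply (h : A →ₗ[k] MixableShuffle lam A →ₗ[k] N) (s : A →ₗ[k] N →ₗ[k] N)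
    (a : A) (x : MixableShuffle lam A × N) :
    recStep h s a x = (cons a x.1, h a x.1 + s a x.2) := rfl

/-- Recursion on words: the linear map `f` with `f nil = n₀` and
`f (cons a w) = h a w + s a (f w)`. -/
def wordRec (n₀ : N) (h : A →ₗ[k] MixableShuffle lam A →ₗ[k] N) (s : A →ₗ[k] N →ₗ[k] N) :
    MixableShuffle lam A →ₗ[k] N :=
  (LinearMap.snd k (MixableShuffle lam A) N) ∘ₗ
    (LinearMap.applyₗ (R := k) ((nil, n₀) : MixableShuffle lam A × N)) ∘ₗ
      (TensorAlgebra.lift k (recStep h s)).toLinearMap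

variable (n₀ : N) (h : A →ₗ[k] MixableShuffle lam A →ₗ[k] N) (s : A →ₗ[k] N →ₗ[k] N)

theorem lift_recStep_fst (w : MixableShuffle lam A) :
    (TensorAlgebra.lift k (recStep h s) w (nil, n₀)).1 = w := by
  induction w using MixableShuffle.induction with
  | h_nil => exact congrArg (fun f : Module.End k _ => (f (nil, n₀)).1) (map_one _)
  | h_cons a w ih =>
    have : TensorAlgebra.lift k (recStep h s) (cons a w) =
        recStep h s a * TensorAlgebra.lift k (recStep h s) w := by
      refine (map_mul _ (TensorAlgebra.ι k a) w).trans ?_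
      rw [TensorAlgebra.lift_ι_apply]
    rw [this, Module.End.mul_apply, recStep_apply, ih]
  | h_add v w hv hw =>
    refine (congrArg (fun f : Module.End k _ => (f (nil, n₀)).1)
      (map_add (TensorAlgebra.lift k (recStep h s)) v w)).trans ?_
    exact congrArg₂ (· + ·) hv hw
  | h_smul c w hw =>
    refine (congrArg (fun f : Module.End k _ => (f (nil, n₀)).1)
      (map_smul (TensorAlgebra.lift k (recStep h s)) c w)).trans ?_
    exact congrArg (c • ·) hw

@[simp]
theorem wordRec_nil : wordRec n₀ h s nil = n₀ :=
  congrArg (fun f : Module.End k _ => (f (nil, n₀)).2) (map_one (TensorAlgebra.lift k (recStep h s)))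

@[simp]
theorem wordRec_cons (a : A) (w : MixableShuffle lam A) :
    wordRec n₀ h s (cons a w) = h a w + s a (wordRec n₀ h s w) := by
  have : TensorAlgebra.lift k (recStep h s) (cons a w) =
      recStep h s a * TensorAlgebra.lift k (recStep h s) w := by
    refine (map_mul _ (TensorAlgebra.ι k a) w).trans ?_
    rw [TensorAlgebra.lift_ι_apply]
  change (TensorAlgebra.lift k (recStep h s) (cons a w) (nil, n₀)).2 = _
  rw [this, Module.End.mul_apply, recStep_apply, lift_recStep_fst]
  rfl

end Recursion

/-- Given the operator `F = (u ш ·)`, the operator `(cons a u ш ·)`, by recursion on the second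
factor: `nil ↦ cons a (F nil)` and
`cons b v ↦ cons a (F (cons b v)) + lam • cons (a * b) (F v) + cons b (cons a u ш v)`. -/
def shuffleStepFun (a : A) (F : Module.End k (MixableShuffle lam A)) :
    Module.End k (MixableShuffle lam A) :=
  wordRec (cons a (F nil))
    ((LinearMap.compr₂ cons ((cons a) ∘ₗ F)) +
      lam • (LinearMap.compl₂ (cons ∘ₗ LinearMap.mulLeft k a) F))
    cons

theorem shuffleStepFun_nil (a : A) (F : Module.End k (MixableShuffle lam A)) :
    shuffleStepFun a F nil = cons a (F nil) := by
  simp [shuffleStepFun]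

theorem shuffleStepFun_cons (a b : A) (F : Module.End k (MixableShuffle lam A))
    (v : MixableShuffle lam A) :
    shuffleStepFun a F (cons b v) =
      cons a (F (cons b v)) + lam • cons (a * b) (F v) + cons b (shuffleStepFun a F v) := by
  simp [shuffleStepFun]

/-- `shuffleStepFun` as a bilinear map. -/
def shuffleStep : A →ₗ[k] Module.End k (MixableShuffle lam A) →ₗ[k]
    Module.End k (MixableShuffle lam A) :=
  LinearMap.mk₂ k shuffleStepFun
    (fun a b F => by
      ext v
      induction v using MixableShuffle.induction with
      | h_nil => simp [shuffleStepFun_nil]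
      | h_cons c v ih =>
        rw [LinearMap.add_apply] at ih
        simp only [shuffleStepFun_cons, LinearMap.add_apply, ih, add_mul, map_add, smul_add]
        abel
      | h_add v w hv hw => rw [map_add, map_add, hv, hw]
      | h_smul c v hv => rw [map_smul, map_smul, hv])
    (fun c a F => by
      ext v
      induction v using MixableShuffle.induction with
      | h_nil => simp [shuffleStepFun_nil]
      | h_cons b v ih =>
        rw [LinearMap.smul_apply] at ih
        simp only [shuffleStepFun_cons, LinearMap.smul_apply, ih, smul_mul_assoc, map_smul]
        module
      | h_add v w hv hw => rw [map_add, map_add, hv, hw]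
      | h_smul c v hv => rw [map_smul, map_smul, hv])
    (fun a F G => by
      ext v
      induction v using MixableShuffle.induction with
      | h_nil => simp [shuffleStepFun_nil]
      | h_cons c v ih =>
        rw [LinearMap.add_apply] at ih
        simp only [shuffleStepFun_cons, LinearMap.add_apply, ih, map_add, smul_add]
        abel
      | h_add v w hv hw => rw [map_add, map_add, hv, hw]
      | h_smul c v hv => rw [map_smul, map_smul, hv])
    (fun c a F => by
      ext v
      induction v using MixableShuffle.induction with
      | h_nil => simp [shuffleStepFun_nil]
      | h_cons b v ih =>
        rw [LinearMap.smul_apply] at ih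
        simp only [shuffleStepFun_cons, LinearMap.smul_apply, ih, map_smul]
        module
      | h_add v w hv hw => rw [map_add, map_add, hv, hw]
      | h_smul c v hv => rw [map_smul, map_smul, hv])

/-- The mixable shuffle product of weight `lam`; the three rules `shuffle_nil_left`,
`shuffle_nil_right` and `shuffle_cons_cons` below characterize it. -/
def shuffle : MixableShuffle lam A →ₗ[k] MixableShuffle lam A →ₗ[k] MixableShuffle lam A :=
  wordRec LinearMap.id 0 shuffleStep

theorem shuffle_nil_left (v : MixableShuffle lam A) : shuffle nil v = v := by
  simp [shuffle]

theorem shuffle_cons (a : A) (u : MixableShuffle lam A) :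
    shuffle (cons a u) = shuffleStepFun a (shuffle u) := by
  simp [shuffle, shuffleStep]

theorem shuffle_nil_right (u : MixableShuffle lam A) : shuffle u nil = u := by
  induction u using MixableShuffle.induction with
  | h_nil => exact shuffle_nil_left nil
  | h_cons a u ih => rw [shuffle_cons, shuffleStepFun_nil, ih]
  | h_add v w hv hw => rw [map_add, LinearMap.add_apply, hv, hw]
  | h_smul c v hv => rw [map_smul, LinearMap.smul_apply, hv]

theorem shuffle_cons_cons (a b : A) (u v : MixableShuffle lam A) :
    shuffle (cons a u) (cons b v) =
      cons a (shuffle u (cons b v)) + cons b (shuffle (cons a u) v) +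
        lam • cons (a * b) (shuffle u v) := by
  rw [shuffle_cons, shuffleStepFun_cons]
  abel

theorem shuffle_comm (u v : MixableShuffle lam A) : shuffle u v = shuffle v u := by
  induction u using MixableShuffle.induction generalizing v with
  | h_nil => rw [shuffle_nil_left, shuffle_nil_right]
  | h_cons a u ihu =>
    induction v using MixableShuffle.induction with
    | h_nil => rw [shuffle_nil_left, shuffle_nil_right]
    | h_cons b v ihv =>
      rw [shuffle_cons_cons, shuffle_cons_cons, ihu, ihu, ihv, mul_comm b a]
      abel
    | h_add v w hv hw => rw [map_add, map_add, LinearMap.add_apply, hv, hw]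
    | h_smul c v hv => rw [map_smul, map_smul, LinearMap.smul_apply, hv]
  | h_add u w hu hw => rw [map_add, map_add, LinearMap.add_apply, hu, hw]
  | h_smul c u hu => rw [map_smul, map_smul, LinearMap.smul_apply, hu]

theorem shuffle_assoc (u v w : MixableShuffle lam A) :
    shuffle (shuffle u v) w = shuffle u (shuffle v w) := by
  induction u using MixableShuffle.induction generalizing v w with
  | h_nil => rw [shuffle_nil_left, shuffle_nil_left]
  | h_cons a u ihu =>
    induction v using MixableShuffle.induction generalizing w with
    | h_nil => rw [shuffle_nil_left, shuffle_nil_right]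
    | h_cons b v ihv =>
      induction w using MixableShuffle.induction with
      | h_nil => rw [shuffle_nil_right, shuffle_nil_right]
      | h_cons c w ihw =>
        have e1 : shuffle (shuffle (cons a u) (cons b v)) (cons c w) =
            cons a (shuffle (shuffle u (cons b v)) (cons c w)) +
            cons b (shuffle (shuffle (cons a u) v) (cons c w)) +
            cons c (shuffle (shuffle (cons a u) (cons b v)) w) +
            lam • cons (a * b) (shuffle (shuffle u v) (cons c w)) +
            lam • cons (a * c) (shuffle (shuffle u (cons b v)) w) +
            lam • cons (b * c) (shuffle (shuffle (cons a u) v) w) +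
            lam • lam • cons (a * b * c) (shuffle (shuffle u v) w) := by
          simp only [shuffle_cons_cons, map_add, LinearMap.add_apply, map_smul,
            LinearMap.smul_apply, smul_add]
          abel
        have e2 : shuffle (cons a u) (shuffle (cons b v) (cons c w)) =
            cons a (shuffle u (shuffle (cons b v) (cons c w))) +
            cons b (shuffle (cons a u) (shuffle v (cons c w))) +
            cons c (shuffle (cons a u) (shuffle (cons b v) w)) +
            lam • cons (a * b) (shuffle u (shuffle v (cons c w))) +
            lam • cons (a * c) (shuffle u (shuffle (cons b v) w)) +
            lam • cons (b * c) (shuffle (cons a u) (shuffle v w)) +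
            lam • lam • cons (a * b * c) (shuffle u (shuffle v w)) := by
          simp only [shuffle_cons_cons, map_add, map_smul, smul_add, mul_assoc]
          abel
        rw [e1, e2, ihw]
        simp only [ihu, ihv]
      | h_add v w hv hw => simp only [map_add, hv, hw]
      | h_smul c v hv => simp only [map_smul, hv]
    | h_add v w hv hw => simp only [map_add, LinearMap.add_apply, hv, hw]
    | h_smul c v hv => simp only [map_smul, LinearMap.smul_apply, hv]
  | h_add u w hu hw => simp only [map_add, LinearMap.add_apply, hu, hw]
  | h_smul c u hu => simp only [map_smul, LinearMap.smul_apply, hu]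

/-- The mixable shuffle algebra is a commutative ring for the mixable shuffle product. -/
instance : CommRing (MixableShuffle lam A) :=
  { (inferInstance : AddCommGroup (MixableShuffle lam A)) with
    mul := fun u v => shuffle u v
    one := nil
    left_distrib := fun u v w => map_add (shuffle u) v w
    right_distrib := fun u v w => LinearMap.map_add₂ shuffle u v w
    zero_mul := fun v => LinearMap.map_zero₂ shuffle v
    mul_zero := fun u => map_zero (shuffle u)
    mul_assoc := shuffle_assoc
    one_mul := shuffle_nil_left
    mul_one := shuffle_nil_right
    mul_comm := shuffle_comm }

instance : Algebra k (MixableShuffle lam A) :=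
  Algebra.ofModule (fun c u v => LinearMap.map_smul₂ shuffle c u v)
    (fun c u v => map_smul (shuffle u) c v)

theorem mul_def (u v : MixableShuffle lam A) : u * v = shuffle u v := rfl

theorem one_def : (1 : MixableShuffle lam A) = nil := rfl

/-- `a ⊗ w ↦ cons a w`, the inclusion of `A ⊗ A^{⊗ n} = A^{⊗ (n+1)}`. -/
def consHom : A ⊗[k] MixableShuffle lam A →ₗ[k] MixableShuffle lam A :=
  TensorProduct.lift cons

/-- Splitting off the first letter: `nil ↦ 0` and `cons a w ↦ a ⊗ w`. -/
def uncons : MixableShuffle lam A →ₗ[k] A ⊗[k] MixableShuffle lam A :=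
  wordRec 0 (TensorProduct.mk k A (MixableShuffle lam A)) 0

end MixableShuffle

/-! ## The free commutative differential Rota-Baxter algebra `Ш(A)` -/

/-- `Ш(A) = ⨁ₙ A^{⊗ (n+1)} = A ⊗ T(A)`, where `a₀ ⊗ a₁ ⊗ ⋯ ⊗ aₙ` is read as
`a₀ ⊗ (a₁ ⊗ ⋯ ⊗ aₙ)`. The commutative `k`-algebra structure is that of the tensor product of the
algebra `A` with the mixable shuffle algebra:
`(a₀ ⊗ u) * (b₀ ⊗ v) = (a₀ * b₀) ⊗ (u ш v)`. -/
abbrev Sha {k : Type*} [CommRing k] (lam : k) (A : Type*) [CommRing A] [Algebra k A] : Type _ :=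
  A ⊗[k] MixableShuffle lam A

namespace Sha

variable {k : Type*} [CommRing k] (lam : k) {A : Type*} [CommRing A] [Algebra k A]

variable (A) in
/-- The canonical inclusion `a ↦ a ⊗ 1` of `A` into `Ш(A)`. -/
def incl : A →ₐ[k] Sha lam A := Algebra.TensorProduct.includeLeft

variable (A) in
/-- The Rota-Baxter operator `a₀ ⊗ ⋯ ⊗ aₙ ↦ 1 ⊗ a₀ ⊗ ⋯ ⊗ aₙ`. -/
def integral : Sha lam A →ₗ[k] Sha lam A :=
  (TensorProduct.mk k A (MixableShuffle lam A) 1) ∘ₗ MixableShuffle.consHom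

/-- The operator `d(a₀) ⊗ a₁ ⊗ ⋯ ⊗ aₙ + (a₀ + lam d(a₀)) a₁ ⊗ a₂ ⊗ ⋯ ⊗ aₙ` (only the first summand
for `n = 0`) applied to `a₀ ⊗ ⋯ ⊗ aₙ`. -/
def derivation (d : A →ₗ[k] A) : Sha lam A →ₗ[k] Sha lam A :=
  LinearMap.rTensor (MixableShuffle lam A) d +
    TensorProduct.lift
      (((LinearMap.mul k (Sha lam A)).compl₂ MixableShuffle.uncons) ∘ₗ
        (incl lam A).toLinearMap ∘ₗ (LinearMap.id + lam • d))

theorem mk_mul_mk (a b : A) (u v : MixableShuffle lam A) :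
    (a ⊗ₜ[k] u : Sha lam A) * (b ⊗ₜ[k] v) = (a * b) ⊗ₜ[k] (MixableShuffle.shuffle u v) := by
  rw [Algebra.TensorProduct.tmul_mul_tmul, MixableShuffle.mul_def]

theorem integral_mk (a : A) (w : MixableShuffle lam A) :
    integral lam A (a ⊗ₜ[k] w) = 1 ⊗ₜ[k] MixableShuffle.cons a w := by
  simp [integral, MixableShuffle.consHom]

theorem derivation_mk_nil (d : A →ₗ[k] A) (a : A) :
    derivation lam d (a ⊗ₜ[k] MixableShuffle.nil) = d a ⊗ₜ[k] MixableShuffle.nil := by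
  simp [derivation, MixableShuffle.uncons]

theorem derivation_mk_cons (d : A →ₗ[k] A) (a b : A) (w : MixableShuffle lam A) :
    derivation lam d (a ⊗ₜ[k] MixableShuffle.cons b w) =
      d a ⊗ₜ[k] MixableShuffle.cons b w + (a * b) ⊗ₜ[k] w + lam • ((d a * b) ⊗ₜ[k] w) := by
  simp [derivation, MixableShuffle.uncons, incl, TensorProduct.add_tmul,
    TensorProduct.smul_tmul', add_assoc]

end Sha

end

/-! ### Integro-differential algebras among differential Rota-Baxter algebras -/

section Operators

variable {k : Type*} [CommRing k] {R : Type*} [CommRing R] [Algebra k R] {lam : k}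
  {d P : R →ₗ[k] R}

/-! For commutative algebras, being integro-differential is the same as being differential
Rota-Baxter and satisfying `J (E x * J y) = E x * J y`
(`IsIntegroDifferential.isDifferentialRotaBaxter`,
`IsIntegroDifferential.initialization_evaluation_mul`,
`IsDifferentialRotaBaxter.isIntegroDifferential`). Dividing any free differential Rota-Baxter
algebra by the ideal of these relations therefore imposes exactly what is missing: the quotient
satisfies them, and every morphism to an integro-differential algebra kills them, so it factors
uniquely.

It remains to see that `Ш(A)` is free. The mixable shuffle recursion is the Rota-Baxter identity in
disguise, both for `P_A` and for iterated integrals in a target `R`. A morphism must send `a₀ ⊗ ⋯ ⊗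
aₙ` to `f a₀ * Q (f a₁ * Q (⋯ Q (f aₙ)))`, and this formula works. The Leibniz rule for `d_A` rests
on `MixableShuffle.uncons_shuffle`: removing the first letter is itself a weighted derivation. -/

theorem initialization_apply (x : R) : initialization d P x = P (d x) := rfl

theorem evaluation_apply (x : R) : evaluation d P x = x - P (d x) := rfl

theorem IsIntegroDifferential.derivation_integral (h : IsIntegroDifferential lam d P) (x : R) :
    d (P x) = x :=
  LinearMap.congr_fun h.comp_eq_id x

theorem IsDifferentialRotaBaxter.derivation_integral (h : IsDifferentialRotaBaxter lam d P)
    (x : R) : d (P x) = x :=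
  LinearMap.congr_fun h.comp_eq_id x

/-- Every integro-differential algebra is a differential Rota-Baxter algebra. -/
theorem IsIntegroDifferential.isDifferentialRotaBaxter (h : IsIntegroDifferential lam d P) :
    IsDifferentialRotaBaxter lam d P where
  derivation := h.derivation
  comp_eq_id := h.comp_eq_id
  rotaBaxter x y := by
    -- At `P x`, `P y` every `P ∘ d ∘ P` collapses to `P`, and Leibniz expands `d (P x * P y)` into
    -- the three Rota-Baxter terms.
    have e := h.hybrid (P x) (P y)
    rw [h.derivation.leibniz] at e
    simp only [h.derivation_integral, map_add, map_smul] at e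
    linear_combination -e

/-- In an integro-differential algebra, constants commute with the initialization. -/
theorem IsIntegroDifferential.initialization_evaluation_mul (h : IsIntegroDifferential lam d P)
    (x y : R) :
    initialization d P (evaluation d P x * initialization d P y) =
      evaluation d P x * initialization d P y := by
  -- Since `d (E x) = 0`, only the last two terms of the hybrid identity survive.
  have e := h.hybrid (evaluation d P x) (initialization d P y)
  simp only [initialization_apply, evaluation_apply, h.derivation_integral, map_sub, sub_self,
    map_zero, zero_mul, zero_add] at e ⊢
  exact (sub_eq_zero.1 e.symm).symm

/-- A commutative differential Rota-Baxter algebra in which constants commute with the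
initialization is an integro-differential algebra. -/
theorem IsDifferentialRotaBaxter.isIntegroDifferential (h : IsDifferentialRotaBaxter lam d P)
    (hJ : ∀ x y, initialization d P (evaluation d P x * initialization d P y) =
      evaluation d P x * initialization d P y) :
    IsIntegroDifferential lam d P where
  derivation := h.derivation
  comp_eq_id := h.comp_eq_id
  hybrid x y := by
    have hE (z : R) : d (z - P (d z)) = 0 := by rw [map_sub, h.derivation_integral, sub_self]
    have e₁ := hJ x y
    have e₂ := hJ y x
    -- The Rota-Baxter identity puts the product in the image of `P`, where `J` is the identity.
    have e₃ : P (d (P (d x) * P (d y))) = P (d x) * P (d y) := by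
      rw [h.rotaBaxter]
      simp only [map_add, map_smul, h.derivation_integral]
    -- A product of constants is constant.
    have e₄ : P (d ((x - P (d x)) * (y - P (d y)))) = 0 := by
      rw [h.derivation.leibniz, hE, hE]
      simp
    simp only [initialization_apply, evaluation_apply] at e₁ e₂
    -- Multiply out `(J x + E x) * (J y + E y)`: `J` fixes the first three terms and kills the last,
    -- which is the hybrid identity rearranged.
    have e : x * y = P (d x) * P (d y) + (x - P (d x)) * P (d y) + (y - P (d y)) * P (d x) +
        (x - P (d x)) * (y - P (d y)) := by ring
    have e₅ := congrArg (fun z => P (d z)) e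
    simp only [map_add] at e₅
    simp only [e₁, e₂, e₃, e₄] at e₅
    linear_combination e₅

end Operators

/-! ### Passage to the quotient -/

section Quotient

variable {k : Type*} [CommRing k] {R : Type*} [CommRing R] [Algebra k R] {lam : k}
  {d P : R →ₗ[k] R}

theorem differentialRotaBaxterSpan_le {S : Set R} {I : Ideal R}
    (hI : IsDifferentialRotaBaxterIdeal d P I) (hS : S ⊆ I) :
    differentialRotaBaxterSpan d P S ≤ I :=
  sInf_le ⟨hI, hS⟩

theorem subset_differentialRotaBaxterSpan (S : Set R) :
    S ⊆ differentialRotaBaxterSpan d P S := fun _ hx =>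
  Submodule.mem_sInf.2 fun _ hI => hI.2 hx

/-- The operators induced on the quotient by the integro-differential ideal form a differential
Rota-Baxter algebra. -/
theorem IsDifferentialRotaBaxter.quotient (h : IsDifferentialRotaBaxter lam d P) :
    IsDifferentialRotaBaxter lam (quotientDerivation d P) (quotientIntegral d P) where
  derivation :=
    { leibniz := by
        rintro ⟨x⟩ ⟨y⟩
        exact congrArg (Ideal.Quotient.mk _) (h.derivation.leibniz x y)
      map_one := (congrArg (Ideal.Quotient.mk _) h.derivation.map_one).trans (map_zero _) }
  rotaBaxter := by
    rintro ⟨x⟩ ⟨y⟩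
    exact congrArg (Ideal.Quotient.mk _) (h.rotaBaxter x y)
  comp_eq_id := by
    refine LinearMap.ext ?_
    rintro ⟨x⟩
    exact congrArg (Ideal.Quotient.mk _) (h.derivation_integral x)

theorem IsDifferentialRotaBaxter.isIntegroDifferential_quotient
    (h : IsDifferentialRotaBaxter lam d P) :
    IsIntegroDifferential lam (quotientDerivation d P) (quotientIntegral d P) := by
  refine h.quotient.isIntegroDifferential ?_
  rintro ⟨x⟩ ⟨y⟩
  -- On representatives, the required relation is one of the generators of the ideal.
  exact Ideal.Quotient.eq.2 (subset_differentialRotaBaxterSpan _ ⟨x, y, rfl⟩)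

/-- A morphism to an integro-differential algebra kills the integro-differential ideal. -/
theorem integroDifferentialIdeal_le_ker {R' : Type*} [CommRing R'] [Algebra k R']
    {δ Q : R' →ₗ[k] R'} (h : IsIntegroDifferential lam δ Q) (g : R →ₐ[k] R')
    (hd : ∀ x, g (d x) = δ (g x)) (hP : ∀ x, g (P x) = Q (g x)) :
    integroDifferentialIdeal d P ≤ RingHom.ker g := by
  refine differentialRotaBaxterSpan_le ⟨fun x hx => ?_, fun x hx => ?_⟩ ?_
  · rw [RingHom.mem_ker] at hx ⊢
    rw [hd, hx, map_zero]
  · rw [RingHom.mem_ker] at hx ⊢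
    rw [hP, hx, map_zero]
  · rintro _ ⟨x, y, rfl⟩
    have e := h.initialization_evaluation_mul (g x) (g y)
    simp only [initialization_apply, evaluation_apply] at e
    simp only [SetLike.mem_coe, RingHom.mem_ker, initialization_apply, evaluation_apply, map_sub,
      map_mul, hd, hP] at e ⊢
    exact sub_eq_zero.2 e

/-- The quotient of a free commutative differential Rota-Baxter algebra by the
integro-differential ideal is a free commutative integro-differential algebra. -/
theorem IsFreeCommDifferentialRotaBaxter.quotient {A : Type*} [CommRing A] [Algebra k A]
    {dA : A →ₗ[k] A} {i : A →ₐ[k] R}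
    (h : IsFreeCommDifferentialRotaBaxter.{w} lam dA d P i) :
    IsFreeCommIntegroDifferential.{w} lam dA (quotientDerivation d P) (quotientIntegral d P)
      ((Ideal.Quotient.mkₐ k (integroDifferentialIdeal d P)).comp i) where
  isIntegroDifferential := h.isDifferentialRotaBaxter.isIntegroDifferential_quotient
  map_derivation a := congrArg (Ideal.Quotient.mk _) (h.map_derivation a)
  existsUnique_lift R' _ _ δ Q hR' f hf := by
    obtain ⟨g, ⟨hgd, hgP, hgi⟩, huniq⟩ :=
      h.existsUnique_lift R' δ Q hR'.isDifferentialRotaBaxter f hf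
    have hker := integroDifferentialIdeal_le_ker hR' g hgd hgP
    refine ⟨Ideal.Quotient.liftₐ _ g fun a ha => hker ha, ⟨?_, ?_, ?_⟩, ?_⟩
    · rintro ⟨x⟩
      exact hgd x
    · rintro ⟨x⟩
      exact hgP x
    · ext a
      exact DFunLike.congr_fun hgi a
    · rintro g' ⟨hd', hP', hi'⟩
      -- Maps out of the quotient are determined after composition with the projection, where
      -- uniqueness for `R` applies.
      refine Ideal.Quotient.algHom_ext k ?_
      refine (huniq (g'.comp (Ideal.Quotient.mkₐ k _)) ⟨fun x => ?_, fun x => ?_, ?_⟩).trans ?_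
      · exact hd' (Ideal.Quotient.mk _ x)
      · exact hP' (Ideal.Quotient.mk _ x)
      · exact hi'
      · ext x
        rfl

end Quotient

/-! ### First-letter removal and iterated integrals on words -/

namespace MixableShuffle

variable {k : Type*} [CommRing k] {lam : k} {A : Type*} [CommRing A] [Algebra k A]

@[simp]
theorem uncons_nil : uncons (nil : MixableShuffle lam A) = 0 := by
  simp [uncons]

@[simp]
theorem uncons_cons (a : A) (w : MixableShuffle lam A) : uncons (cons a w) = a ⊗ₜ[k] w := by
  simp [uncons]

/-- Splitting off the first letter is a derivation of weight `lam` along the inclusion of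
`MixableShuffle lam A` into `Sha lam A`. -/
theorem uncons_shuffle (u v : MixableShuffle lam A) :
    (uncons (shuffle u v) : Sha lam A) =
      uncons u * (1 ⊗ₜ v) + (1 ⊗ₜ u) * uncons v + lam • (uncons u * uncons v) := by
  induction u using MixableShuffle.induction with
  | h_nil =>
    rw [shuffle_nil_left, uncons_nil, zero_mul, zero_mul, smul_zero, zero_add, add_zero]
    exact (one_mul (uncons v : Sha lam A)).symm
  | h_cons a u ihu =>
    -- Only the first letters matter, so both inductions serve as case distinctions.
    clear ihu
    induction v using MixableShuffle.induction with
    | h_nil =>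
      rw [shuffle_nil_right, uncons_nil, mul_zero, mul_zero, smul_zero, add_zero, add_zero]
      exact (mul_one (uncons (cons a u) : Sha lam A)).symm
    | h_cons b v =>
      rw [shuffle_cons_cons]
      -- The three terms of the shuffle recursion are the three terms of the Leibniz rule.
      simp only [map_add, map_smul, uncons_cons, Sha.mk_mul_mk, mul_one, one_mul]
    | h_add v w hv hw =>
      simp only [map_add, hv, hw, TensorProduct.tmul_add, mul_add, smul_add]
      abel
    | h_smul c v hv =>
      simp only [map_smul, hv, TensorProduct.tmul_smul, mul_smul_comm]
      module
  | h_add u w hu hw =>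
    simp only [map_add, LinearMap.add_apply, hu, hw, TensorProduct.tmul_add, add_mul, smul_add]
    abel
  | h_smul c u hu =>
    simp only [map_smul, LinearMap.smul_apply, hu, TensorProduct.tmul_smul, smul_mul_assoc]
    module

section Lift

variable {R : Type*} [CommRing R] [Algebra k R]

/-- The linear map `a₁ ⊗ ⋯ ⊗ aₙ ↦ Q (f a₁ * Q (f a₂ * ⋯ Q (f aₙ)))`. -/
def iteratedIntegral (Q : R →ₗ[k] R) (f : A →ₐ[k] R) : MixableShuffle lam A →ₗ[k] R :=
  wordRec 1 0 ((LinearMap.mul k R).compr₂ Q ∘ₗ f.toLinearMap)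

variable (Q : R →ₗ[k] R) (f : A →ₐ[k] R)

@[simp]
theorem iteratedIntegral_nil : iteratedIntegral Q f (nil : MixableShuffle lam A) = 1 := by
  simp [iteratedIntegral]

@[simp]
theorem iteratedIntegral_cons (a : A) (w : MixableShuffle lam A) :
    iteratedIntegral Q f (cons a w) = Q (f a * iteratedIntegral Q f w) := by
  simp [iteratedIntegral]

variable {Q}

/-- The Rota-Baxter identity for a product of two integrals reproduces the shuffle recursion on
first letters term by term. -/
theorem iteratedIntegral_shuffle (hQ : IsRotaBaxterOperator lam Q) (u v : MixableShuffle lam A) :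
    iteratedIntegral Q f (shuffle u v) = iteratedIntegral Q f u * iteratedIntegral Q f v := by
  induction u using MixableShuffle.induction generalizing v with
  | h_nil => rw [shuffle_nil_left, iteratedIntegral_nil, one_mul]
  | h_cons a u ihu =>
    induction v using MixableShuffle.induction with
    | h_nil => rw [shuffle_nil_right, iteratedIntegral_nil, mul_one]
    | h_cons b v ihv =>
      rw [shuffle_cons_cons]
      simp only [map_add, map_smul, map_mul, iteratedIntegral_cons, ihu, ihv]
      rw [hQ]
      simp only [mul_assoc, mul_left_comm]
    | h_add v w hv hw => simp only [map_add, mul_add, hv, hw]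
    | h_smul c v hv => simp only [map_smul, mul_smul_comm, hv]
  | h_add u w hu hw => simp only [map_add, LinearMap.add_apply, add_mul, hu, hw]
  | h_smul c u hu => simp only [map_smul, LinearMap.smul_apply, smul_mul_assoc, hu]

/-- `iteratedIntegral` as an algebra homomorphism, for a Rota-Baxter operator. -/
def iteratedIntegralHom (hQ : IsRotaBaxterOperator lam Q) : MixableShuffle lam A →ₐ[k] R :=
  AlgHom.ofLinearMap (iteratedIntegral Q f) (iteratedIntegral_nil Q f)
    (iteratedIntegral_shuffle f hQ)

@[simp]
theorem iteratedIntegralHom_apply (hQ : IsRotaBaxterOperator lam Q) (w : MixableShuffle lam A) :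
    iteratedIntegralHom f hQ w = iteratedIntegral Q f w := rfl

end Lift

end MixableShuffle

/-! ### `Ш(A)` as a free differential Rota-Baxter algebra -/

namespace Sha

open MixableShuffle

variable {k : Type*} [CommRing k] {lam : k} {A : Type*} [CommRing A] [Algebra k A]

/-- Linear induction over the elements `a₀` and `a₀ ⊗ a₁ ⊗ ⋯ ⊗ aₙ` with `n ≥ 1`. -/
theorem induction_word {p : Sha lam A → Prop} (h_nil : ∀ a : A, p (a ⊗ₜ nil))
    (h_cons : ∀ (a b : A) w, p (a ⊗ₜ cons b w)) (h_add : ∀ x y, p x → p y → p (x + y))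
    (x : Sha lam A) : p x := by
  induction x using TensorProduct.induction_on with
  | zero => simpa using h_nil 0
  | tmul a w =>
    induction w using MixableShuffle.induction generalizing a with
    | h_nil => exact h_nil a
    | h_cons b w => exact h_cons a b w
    | h_add v w hv hw =>
      rw [TensorProduct.tmul_add]
      exact h_add _ _ (hv a) (hw a)
    | h_smul c w hw =>
      -- The scalar is absorbed into the letter `a`, over which the hypothesis is generalized.
      rw [← TensorProduct.smul_tmul]
      exact hw _
  | add x y hx hy => exact h_add _ _ hx hy

/-- Treats empty and nonempty words uniformly, and uses only products in `Sha lam A`, so that the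
Leibniz rule becomes a ring identity. -/
theorem derivation_mk (d : A →ₗ[k] A) (a : A) (w : MixableShuffle lam A) :
    derivation lam d (a ⊗ₜ w) =
      incl lam A (d a) * (1 ⊗ₜ w) +
        incl lam A (a + lam • d a) * (uncons w : Sha lam A) := by
  have e : incl lam A (d a) * (1 ⊗ₜ w) = (d a ⊗ₜ w : Sha lam A) := by
    simp [incl]
  rw [e]
  simp only [derivation, LinearMap.add_apply, LinearMap.rTensor_tmul, TensorProduct.lift.tmul]
  rfl

theorem mk_eq_incl_mul (a : A) (w : MixableShuffle lam A) :
    (a ⊗ₜ w : Sha lam A) = incl lam A a * (1 ⊗ₜ w) := by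
  simp [incl]

/-- Both `d` on the first factor and `uncons` on words obey the weighted Leibniz rule, and `a ↦ a +
lam • d a` is multiplicative; the combination in `derivation_mk` then obeys the rule too. -/
theorem isWeightedDerivation {d : A →ₗ[k] A} (hd : IsWeightedDerivation lam d) :
    IsWeightedDerivation lam (derivation lam d) where
  map_one := by
    refine (derivation_mk_nil lam d 1).trans ?_
    rw [hd.map_one, TensorProduct.zero_tmul]
  leibniz x y := by
    induction x using TensorProduct.induction_on with
    | zero => simp
    | add x z hx hz =>
      simp only [add_mul, map_add, hx, hz, smul_add]
      abel
    | tmul a u =>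
      induction y using TensorProduct.induction_on with
      | zero => simp
      | add x z hx hz =>
        simp only [mul_add, map_add, hx, hz, smul_add]
        abel
      | tmul b v =>
        have e : (1 ⊗ₜ shuffle u v : Sha lam A) = (1 ⊗ₜ u) * (1 ⊗ₜ v) := by
          rw [mk_mul_mk, one_mul]
        rw [mk_mul_mk]
        -- Scalars become ring elements, so that `ring` can finish.
        have hs (x : Sha lam A) : lam • x = algebraMap k _ lam * x := Algebra.smul_def lam x
        simp only [derivation_mk, uncons_shuffle, hd.leibniz, map_add, map_mul, map_smul, e]
        rw [mk_eq_incl_mul a u, mk_eq_incl_mul b v]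
        simp only [Algebra.smul_def, hs]
        ring

/-- Values of `P_A` have first factor `1`, so their product is a pure shuffle of nonempty words, and
its recursion is the identity sought. -/
theorem isRotaBaxterOperator : IsRotaBaxterOperator lam (integral lam A) := by
  intro x y
  induction x using TensorProduct.induction_on with
  | zero => simp
  | add x z hx hz =>
    simp only [add_mul, map_add, hx, hz, smul_add]
    abel
  | tmul a u =>
    induction y using TensorProduct.induction_on with
    | zero => simp
    | add x z hx hz =>
      simp only [mul_add, map_add, hx, hz, smul_add]
      abel
    | tmul b v =>
      simp only [integral_mk, mk_mul_mk, one_mul, mul_one, shuffle_cons_cons,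
        TensorProduct.tmul_add, TensorProduct.tmul_smul]

theorem isDifferentialRotaBaxter {d : A →ₗ[k] A} (hd : IsWeightedDerivation lam d) :
    IsDifferentialRotaBaxter lam (derivation lam d) (integral lam A) where
  derivation := isWeightedDerivation hd
  rotaBaxter := isRotaBaxterOperator
  comp_eq_id := by
    refine TensorProduct.ext' fun a w => ?_
    -- As `d 1 = 0`, only the middle term `(1 * a) ⊗ w` remains.
    rw [LinearMap.comp_apply, integral_mk, derivation_mk_cons, hd.map_one]
    simp

section Lift

variable {R : Type*} [CommRing R] [Algebra k R] {δ Q : R →ₗ[k] R}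

/-- The extension of an algebra homomorphism `f : A → R` to `Sha lam A`, for a Rota-Baxter operator
on `R`. -/
def lift (hQ : IsRotaBaxterOperator lam Q) (f : A →ₐ[k] R) : Sha lam A →ₐ[k] R :=
  Algebra.TensorProduct.lift f (iteratedIntegralHom f hQ) fun _ _ => Commute.all _ _

@[simp]
theorem lift_mk (hQ : IsRotaBaxterOperator lam Q) (f : A →ₐ[k] R) (a : A)
    (w : MixableShuffle lam A) :
    lift hQ f (a ⊗ₜ w) = f a * iteratedIntegral Q f w := by
  simp [lift]

theorem lift_integral (hQ : IsRotaBaxterOperator lam Q) (f : A →ₐ[k] R) (x : Sha lam A) :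
    lift hQ f (integral lam A x) = Q (lift hQ f x) := by
  induction x using TensorProduct.induction_on with
  | zero => simp
  | tmul a w => rw [integral_mk, lift_mk, lift_mk, iteratedIntegral_cons, map_one, one_mul]
  | add x y hx hy => simp only [map_add, hx, hy]

/-- Leibniz together with `δ ∘ Q = id`, applied to `f a * Q (f b * r)`, yields exactly the three
terms that define `d_A`. -/
theorem lift_derivation (h : IsDifferentialRotaBaxter lam δ Q) {d : A →ₗ[k] A} {f : A →ₐ[k] R}
    (hf : ∀ a, f (d a) = δ (f a)) (x : Sha lam A) :
    lift h.rotaBaxter f (derivation lam d x) = δ (lift h.rotaBaxter f x) := by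
  induction x using Sha.induction_word with
  | h_nil a => simp [derivation_mk_nil, hf]
  | h_cons a b w =>
    rw [derivation_mk_cons]
    simp only [map_add, map_smul, lift_mk, iteratedIntegral_cons, h.derivation.leibniz,
      h.derivation_integral, hf, map_mul, mul_assoc]
  | h_add x y hx hy => simp only [map_add, hx, hy]

theorem lift_comp_incl (hQ : IsRotaBaxterOperator lam Q) (f : A →ₐ[k] R) :
    (lift hQ f).comp (incl lam A) = f :=
  Algebra.TensorProduct.lift_comp_includeLeft _ _ _

/-- `Ш(A)` is generated by `A` under linear combinations, products and `P_A`: a pure tensor is `a *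
(1 ⊗ w)`, and prefixing `1` to a nonempty word is an application of `P_A`. -/
theorem eq_lift (hQ : IsRotaBaxterOperator lam Q) {f : A →ₐ[k] R} {g : Sha lam A →ₐ[k] R}
    (hP : ∀ x, g (integral lam A x) = Q (g x)) (hi : g.comp (incl lam A) = f) :
    g = lift hQ f := by
  have hg (a : A) (w : MixableShuffle lam A) : g (a ⊗ₜ w) = f a * g (1 ⊗ₜ w) := by
    rw [mk_eq_incl_mul, map_mul, ← hi]
    rfl
  have hw (w : MixableShuffle lam A) : g (1 ⊗ₜ w) = iteratedIntegral Q f w := by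
    induction w using MixableShuffle.induction with
    | h_nil =>
      rw [iteratedIntegral_nil]
      exact map_one g
    | h_cons a w ih => rw [← integral_mk, hP, hg, ih, iteratedIntegral_cons]
    | h_add v w hv hw => rw [TensorProduct.tmul_add, map_add, map_add, hv, hw]
    | h_smul c w hw => rw [TensorProduct.tmul_smul, map_smul, map_smul, hw]
  refine AlgHom.toLinearMap_injective (TensorProduct.ext' fun a w => ?_)
  change g (a ⊗ₜ w) = lift hQ f (a ⊗ₜ w)
  rw [hg, hw, lift_mk]

end Lift

/-- `Sha lam A` is the free commutative differential Rota-Baxter algebra on `(A, d)`. -/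
theorem isFreeCommDifferentialRotaBaxter {d : A →ₗ[k] A} (hd : IsWeightedDerivation lam d) :
    IsFreeCommDifferentialRotaBaxter.{w} lam d (derivation lam d) (integral lam A)
      (incl lam A) where
  isDifferentialRotaBaxter := isDifferentialRotaBaxter hd
  map_derivation a := (derivation_mk_nil lam d a).symm
  existsUnique_lift _ _ _ _ _ h f hf :=
    ⟨lift h.rotaBaxter f,
      ⟨lift_derivation h hf, lift_integral h.rotaBaxter f, lift_comp_incl h.rotaBaxter f⟩,
      fun _ hg => eq_lift h.rotaBaxter hg.2.1 hg.2.2⟩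

end Sha

theorem theorem3p6 {k : Type u} [CommRing k] (lam : k) {A : Type v} [CommRing A] [Algebra k A]
    (d : A →ₗ[k] A) (hd : IsWeightedDerivation lam d) :
    IsFreeCommDifferentialRotaBaxter.{w} lam d (Sha.derivation lam d) (Sha.integral lam A)
      (Sha.incl lam A) ∧
    IsDifferentialRotaBaxter lam
      (quotientDerivation (Sha.derivation lam d) (Sha.integral lam A))
      (quotientIntegral (Sha.derivation lam d) (Sha.integral lam A)) ∧
    IsFreeCommIntegroDifferential.{w} lam d
      (quotientDerivation (Sha.derivation lam d) (Sha.integral lam A))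
      (quotientIntegral (Sha.derivation lam d) (Sha.integral lam A))
      ((Ideal.Quotient.mkₐ k
        (integroDifferentialIdeal (Sha.derivation lam d) (Sha.integral lam A))).comp
        (Sha.incl lam A)) :=
  have h := Sha.isFreeCommDifferentialRotaBaxter hd
  ⟨h, h.isDifferentialRotaBaxter.quotient, h.quotient⟩
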